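/- Theorem. A complex affine variety means here a subset of some $\mathbb{C}^n$ which is the set of common zeros of a family of polynomials (not necessarily irreducible), with its Zariski topology; morphisms are maps given by polynomials in the coordinates. Let $G$ be an algebraic group over $\mathbb{C}$, that is, an affine variety with a group structure whose product $G\times G\to G$ and inverse $G\to G$ are morphisms. A finite-dimensional $G$-module is a finite-dimensional complex representation of $G$ whose matrix coefficients are regular functions on $G$. Suppose that $G$ satisfies the Nagata hypothesis: for every finite-dimensional $G$-module $M$ and every $G$-invariant hyperplane $N\subseteq M$ such that $G$ acts trivially on $M/N$, there is a decomposition $M=H\oplus P$ as $G$-modules in which $H$ is a hyperplane (codimension one) and $P$ is a trivial representation. Let $G$ act on an affine variety $Z$ through a morphism $G\times Z\to Z$. Let $\mathbb{C}[Z]^G$ be the ring of $G$-invariant regular functions on $Z$, and for $z\in Z$ let $\Delta(z)$ be the closure in $Z$ of the orbit of $z$. For $z_1,z_2\in Z$ define $z_1\approx z_2$ if and only if $\Delta(z_1)\cap\Delta(z_2)\neq\emptyset$. Then: (i) $\approx$ is an equivalence relation on $Z$. (ii) $z_1\approx z_2$ if and only if $f(z_1)=f(z_2)$ for all $f\in\mathbb{C}[Z]^G$.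 (iii) For every $z\in Z$, the set $\Delta(z)$ contains exactly one orbit that is closed in $Z$, and the dimension of this orbit is minimal among the dimensions of all orbits contained in $\Delta(z)$. (The dimension of an orbit is its Krull dimension in the induced Zariski topology.) -/

import Mathlib

noncomputable section

namespace AffineGIT

open MvPolynomial

/-- The set of common zeros in `ℂⁿ` of a set `S` of polynomials. -/
def zeroSet {n : ℕ} (S : Set (MvPolynomial (Fin n) ℂ)) : Set (Fin n → ℂ) :=
  {x | ∀ p ∈ S, eval x p = 0}

/-- Affine varieties, as closed subsets of `ℂⁿ` (irreducibility is not required). -/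
def IsAffineVariety {n : ℕ} (Z : Set (Fin n → ℂ)) : Prop :=
  ∃ S : Set (MvPolynomial (Fin n) ℂ), Z = zeroSet S

/-- The Zariski topology on `ℂⁿ`: the closed sets are the zero sets. -/
@[reducible] def zariskiSpace (n : ℕ) : TopologicalSpace (Fin n → ℂ) :=
  TopologicalSpace.ofClosed {Z | IsAffineVariety Z}
    ⟨{1}, by ext x; simp [zeroSet]⟩
    (by
      intro A hA
      refine ⟨{p | ∃ S : Set (MvPolynomial (Fin n) ℂ), zeroSet S ∈ A ∧ p ∈ S}, ?_⟩
      ext x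
      constructor
      · rintro hx p ⟨S, hS, hp⟩
        exact hx _ hS p hp
      · intro hx Y hY
        obtain ⟨S, rfl⟩ := hA hY
        exact fun p hp => hx p ⟨S, hY, hp⟩)
    (by
      rintro _ ⟨S, rfl⟩ _ ⟨T, rfl⟩
      refine ⟨{p | ∃ s ∈ S, ∃ t ∈ T, p = s * t}, ?_⟩
      ext x
      constructor
      · rintro (hx | hx) p ⟨s, hs, t, ht, rfl⟩
        · simp [hx s hs]
        · simp [hx t ht]
      · intro hx
        by_contra hcon
        simp only [Set.mem_union, not_or, zeroSet, Set.mem_ofPred_eq, not_forall] at hcon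
        obtain ⟨⟨s, hs, hsx⟩, t, ht, htx⟩ := hcon
        have h := hx (s * t) ⟨s, hs, t, ht, rfl⟩
        rw [map_mul] at h
        exact (mul_ne_zero hsx htx) h)

/-- The Zariski topology on a subset `Z` of `ℂⁿ`. -/
@[reducible] def zariski {n : ℕ} (Z : Set (Fin n → ℂ)) : TopologicalSpace Z :=
  (zariskiSpace n).induced Subtype.val

/-- The Zariski closure, in `Z`, of a subset of `Z`. -/
def zariskiClosure {n : ℕ} {Z : Set (Fin n → ℂ)} (W : Set Z) : Set Z :=
  @closure Z (zariski Z) W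

/-- A subset of `Z` is closed in the Zariski topology of `Z`. -/
def IsZariskiClosed {n : ℕ} {Z : Set (Fin n → ℂ)} (W : Set Z) : Prop :=
  @IsClosed Z (zariski Z) W

/-- The dimension of a subset of `Z`: the supremum of the lengths of chains of irreducible closed
subsets, for the topology induced by the Zariski topology. -/
def zariskiDim {n : ℕ} {Z : Set (Fin n → ℂ)} (W : Set Z) : WithBot ℕ∞ :=
  @topologicalKrullDim W ((zariski Z).induced Subtype.val)

/-- The coordinate ring `ℂ[Z]`: the functions on `Z` that are restrictions of polynomials. -/
def coordinateRing {n : ℕ} (Z : Set (Fin n → ℂ)) : Subalgebra ℂ (Z → ℂ) :=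
  (aeval (R := ℂ) (fun (i : Fin n) (z : Z) => z.1 i)).range

/-- Regular functions on a product `X × Y`: the restrictions of polynomials in both sets of
coordinates. -/
def IsRegularOnProd {m n : ℕ} {X : Set (Fin m → ℂ)} {Y : Set (Fin n → ℂ)}
    (f : X → Y → ℂ) : Prop :=
  ∃ p : MvPolynomial (Fin m ⊕ Fin n) ℂ, ∀ x y, f x y = eval (Sum.elim x.1 y.1) p

/-- `G` is an algebraic group: an affine variety with a group structure whose product
`G × G → G` and inverse `G → G` are morphisms. -/
structure IsAlgebraicGroup {m : ℕ} (G : Set (Fin m → ℂ)) [Group G] : Prop where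
  isAffineVariety : IsAffineVariety G
  regular_mul : ∀ i, IsRegularOnProd fun g h : G => (g * h).1 i
  regular_inv : ∀ i, (fun g : G => (g⁻¹).1 i) ∈ coordinateRing G

/-- A finite-dimensional `G`-module is algebraic: all of its matrix coefficients are regular
functions on `G`. -/
def IsAlgebraicRep {m : ℕ} (G : Set (Fin m → ℂ)) [Group G] {M : Type} [AddCommGroup M]
    [Module ℂ M] (ρ : Representation ℂ G M) : Prop :=
  ∀ (v : M) (ξ : Module.Dual ℂ M), (fun g : G => ξ (ρ g v)) ∈ coordinateRing G

/-- The Nagata hypothesis: whenever a finite-dimensional algebraic `G`-module `M` has an invariant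
hyperplane `N` with trivial quotient `M / N`, there is a decomposition `M = H ⊕ P` into submodules,
where `H` is a hyperplane and `P` is a trivial representation. -/
def NagataHypothesis {m : ℕ} (G : Set (Fin m → ℂ)) [Group G] : Prop :=
  ∀ (M : Type) [AddCommGroup M] [Module ℂ M] [FiniteDimensional ℂ M]
    (ρ : Representation ℂ G M), IsAlgebraicRep G ρ →
    ∀ N : Submodule ℂ M, Module.finrank ℂ (M ⧸ N) = 1 →
      (∀ g, ∀ x ∈ N, ρ g x ∈ N) → (∀ g x, ρ g x - x ∈ N) →
      ∃ H P : Submodule ℂ M, IsCompl H P ∧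
        Module.finrank ℂ (M ⧸ H) = 1 ∧ (∀ g, ∀ x ∈ H, ρ g x ∈ H) ∧
        ∀ g, ∀ x ∈ P, ρ g x = x

/-- The group action `G × Z → Z` is a morphism. -/
def IsAlgebraicAction {m n : ℕ} (G : Set (Fin m → ℂ)) [Group G] (Z : Set (Fin n → ℂ))
    [MulAction G Z] : Prop :=
  ∀ i, IsRegularOnProd fun (g : G) (z : Z) => (g • z).1 i

/-- The ring `ℂ[Z]^G` of invariant regular functions. -/
def invariantRing {m n : ℕ} (G : Set (Fin m → ℂ)) [Group G] (Z : Set (Fin n → ℂ))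
    [MulAction G Z] : Subalgebra ℂ (Z → ℂ) where
  carrier := {f | f ∈ coordinateRing Z ∧ ∀ (g : G) (z : Z), f (g • z) = f z}
  mul_mem' := fun ha hb => ⟨mul_mem ha.1 hb.1, fun g z => by simp [ha.2 g z, hb.2 g z]⟩
  add_mem' := fun ha hb => ⟨add_mem ha.1 hb.1, fun g z => by simp [ha.2 g z, hb.2 g z]⟩
  algebraMap_mem' := fun c => ⟨Subalgebra.algebraMap_mem _ c, fun _ _ => rfl⟩

/-- The orbit closure `Δ(z)`: the Zariski closure of the orbit of `z` in `Z`. -/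
def orbitClosure {m n : ℕ} (G : Set (Fin m → ℂ)) [Group G] {Z : Set (Fin n → ℂ)}
    [MulAction G Z] (z : Z) : Set Z :=
  zariskiClosure (MulAction.orbit G z)

/-- The relation `z₁ ≈ z₂`: the orbit closures of `z₁` and `z₂` meet. -/
def ClosuresMeet {m n : ℕ} (G : Set (Fin m → ℂ)) [Group G] {Z : Set (Fin n → ℂ)}
    [MulAction G Z] (z₁ z₂ : Z) : Prop :=
  (orbitClosure G z₁ ∩ orbitClosure G z₂).Nonempty

/-- `W` is a closed orbit contained in `Δ(z)`. -/
def IsClosedOrbitIn {m n : ℕ} (G : Set (Fin m → ℂ)) [Group G] {Z : Set (Fin n → ℂ)}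
    [MulAction G Z] (z : Z) (W : Set Z) : Prop :=
  (∃ w : Z, W = MulAction.orbit G w) ∧ IsZariskiClosed W ∧ W ⊆ orbitClosure G z

end AffineGIT

end

/-! The core is (ii). If two orbit closures are disjoint, the Nullstellensatz gives a regular `f`
equal to 0 on one orbit and 1 on the other. Its translates span a finite-dimensional algebraic
module `V`, on which evaluation at `z₂` is a nonzero invariant functional. The Nagata hypothesis,
applied by descent on dimension, yields an invariant vector of `V` not killed by it
(`NagataHypothesis.exists_invariant`); this vector vanishes at `z₁`, as all of `V` does. Conversely,
invariants are constant on orbit closures. So `≈` is equality of all invariants, which gives (i),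
and two closed orbits in `Δ(z)` must meet, hence coincide.

Existence in (iii) is Noetherian: take a point of `Δ(z)` whose orbit has maximal ideal. By
Chevalley, an orbit contains a nonempty open part of a component of its closure, so orbits with
equal closures coincide. For the dimension, the closed orbit lies in `Δ(w)` for each orbit `Gw` in
`Δ(z)`, and no subset of `Δ(w)` has larger dimension than `Gw`: passing to a nonempty open part of
an irreducible variety does not lower its dimension. -/

/-! ### Krull dimension of finitely generated domains; Chevalley's theorem -/

theorem ringKrullDim_le_of_isIntegral (R S : Type*) [CommRing R] [CommRing S] [Algebra R S]
    [Algebra.IsIntegral R S] : ringKrullDim S ≤ ringKrullDim R :=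
  Order.krullDim_le_of_strictMono (PrimeSpectrum.comap (algebraMap R S))
    fun _ _ h => Ideal.IsIntegral.comap_lt_comap h

/-- Lying over, available by injectivity, lifts the bottom prime of a chain; going up lifts the
rest. -/
theorem ringKrullDim_le_of_isIntegral_of_injective (R S : Type*) [CommRing R] [CommRing S]
    [Algebra R S] [Algebra.IsIntegral R S] (hinj : Function.Injective (algebraMap R S)) :
    ringKrullDim R ≤ ringKrullDim S := by
  refine iSup_le fun l => ?_
  obtain ⟨P, -, hP, hPl⟩ := Ideal.exists_ideal_over_prime_of_isIntegral l.head.asIdeal (⊥ : Ideal S)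
    (by rw [← RingHom.ker_eq_comap_bot, (RingHom.injective_iff_ker_eq_bot _).1 hinj]; exact bot_le)
  have : P.LiesOver l.head.asIdeal := ⟨hPl.symm⟩
  obtain ⟨L, hL, -⟩ := Ideal.exists_ltSeries_of_hasGoingUp l P
  rw [← hL]
  exact le_iSup (fun p : LTSeries (PrimeSpectrum S) => (p.length : WithBot ℕ∞)) L

/-- The Krull dimension of a finitely generated domain over a field is its transcendence degree. -/
theorem exists_ringKrullDim_eq_and_trdeg_eq (k A : Type*) [Field k] [CommRing A] [IsDomain A]
    [Algebra k A] [Algebra.FiniteType k A] :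
    ∃ s : ℕ, ringKrullDim A = s ∧ Algebra.trdeg k A = s := by
  obtain ⟨s, g, hinj, hint⟩ := exists_integral_inj_algHom_of_fg k A
  refine ⟨s, ?_⟩
  algebraize [g.toRingHom]
  have hinj' : Function.Injective (algebraMap (MvPolynomial (Fin s) k) A) := hinj
  have : IsScalarTower k (MvPolynomial (Fin s) k) A := .of_algebraMap_eq fun x => (g.commutes x).symm
  have : Algebra.IsIntegral (MvPolynomial (Fin s) k) A := ⟨hint⟩
  have : FaithfulSMul (MvPolynomial (Fin s) k) A := (faithfulSMul_iff_algebraMap_injective _ _).2 hinj'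
  have : FaithfulSMul k A := (faithfulSMul_iff_algebraMap_injective _ _).2 (algebraMap k A).injective
  constructor
  · rw [le_antisymm (ringKrullDim_le_of_isIntegral (MvPolynomial (Fin s) k) A)
      (ringKrullDim_le_of_isIntegral_of_injective _ A hinj'),
      MvPolynomial.ringKrullDim_of_isNoetherianRing]
    simp
  · have h := lift_trdeg_add_eq k (MvPolynomial (Fin s) k) A
    rw [trdeg_eq_zero (R := MvPolynomial (Fin s) k)] at h
    simpa [eq_comm] using h

/-- Both dimensions are transcendence degrees, and the localization is algebraic over `A`. -/
theorem ringKrullDim_localizationAway (k : Type*) {A : Type*} [Field k] [CommRing A] [IsDomain A]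
    [Algebra k A] [Algebra.FiniteType k A] {f : A} (hf : f ≠ 0) :
    ringKrullDim (Localization.Away f) = ringKrullDim A := by
  have hM : Submonoid.powers f ≤ nonZeroDivisors A := powers_le_nonZeroDivisors_of_noZeroDivisors hf
  have : IsDomain (Localization.Away f) := IsLocalization.isDomain_localization hM
  have : Algebra.FiniteType k (Localization.Away f) := inferInstance
  have : Algebra.IsAlgebraic A (Localization.Away f) := IsLocalization.isAlgebraic _ (.powers f)
  have : FaithfulSMul A (Localization.Away f) :=
    (faithfulSMul_iff_algebraMap_injective _ _).2 (IsLocalization.injective _ hM)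
  have : FaithfulSMul k A := (faithfulSMul_iff_algebraMap_injective _ _).2 (algebraMap k A).injective
  obtain ⟨s, hs, hs'⟩ := exists_ringKrullDim_eq_and_trdeg_eq k A
  obtain ⟨t, ht, ht'⟩ := exists_ringKrullDim_eq_and_trdeg_eq k (Localization.Away f)
  have h := trdeg_add_eq k A (A := Localization.Away f)
  rw [trdeg_eq_zero (R := A), add_zero, hs', ht'] at h
  rw [hs, ht, Nat.cast_injective h]

/-- A dominant morphism of finite type to an integral Noetherian scheme contains a nonempty open
subset in its image. -/
theorem exists_basicOpen_subset_range_comap {A B : Type*} [CommRing A] [IsDomain A]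
    [IsNoetherianRing A] [CommRing B] [IsDomain B] {φ : A →+* B} (hφ : φ.FiniteType)
    (hinj : Function.Injective φ) :
    ∃ a : A, a ≠ 0 ∧ ↑(PrimeSpectrum.basicOpen a) ⊆ Set.range (PrimeSpectrum.comap φ) := by
  obtain ⟨S, hS⟩ := PrimeSpectrum.exists_constructibleSetData_iff.2
    (PrimeSpectrum.isConstructible_range_comap (RingHom.FinitePresentation.of_finiteType.1 hφ))
  -- The image is constructible and contains the generic point. The piece containing that point can
  -- have only trivial closed conditions, so it contains a basic open set.
  have hbot : (⊥ : PrimeSpectrum A) ∈ S.toSet := by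
    rw [hS]
    refine ⟨⊥, PrimeSpectrum.ext ?_⟩
    exact (RingHom.injective_iff_ker_eq_bot _).1 hinj
  obtain ⟨C, hC, hbotC⟩ := Set.mem_iUnion₂.1 hbot
  simp only [PrimeSpectrum.BasicConstructibleSetData.toSet, Set.mem_sdiff,
    PrimeSpectrum.mem_zeroLocus, Set.singleton_subset_iff] at hbotC
  refine ⟨C.f, fun h => hbotC.2 (by simp [h]), ?_⟩
  rw [← hS]
  intro p hp
  refine Set.mem_iUnion₂.2 ⟨C, hC, ?_⟩
  simp only [PrimeSpectrum.BasicConstructibleSetData.toSet, Set.mem_sdiff,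
    PrimeSpectrum.mem_zeroLocus, Set.singleton_subset_iff]
  refine ⟨hbotC.1.trans fun x hx => ?_, hp⟩
  have : x = 0 := hx
  simp [this]

/-! ### Zariski topology, vanishing ideals and dimension -/

namespace AffineGIT

open MvPolynomial

variable {m n : ℕ}

theorem zeroSet_eq_zeroLocus (S : Set (MvPolynomial (Fin n) ℂ)) :
    zeroSet S = zeroLocus ℂ (Ideal.span S) := by
  rw [zeroLocus_span]; rfl

/-- The space `X` with the topology induced from the Zariski topology of `ℂⁿ` by a map. -/
@[reducible] def inducedSpace {X : Type*} (e : X → Fin n → ℂ) : TopologicalSpace X :=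
  (zariskiSpace n).induced e

section Topology

variable {X : Type*} (e : X → Fin n → ℂ)

theorem isClosed_inducedSpace_iff {T : Set X} :
    @IsClosed X (inducedSpace e) T ↔ ∃ W, IsAffineVariety W ∧ e ⁻¹' W = T := by
  rw [@isClosed_induced_iff X (Fin n → ℂ) (zariskiSpace n)]
  refine exists_congr fun W => and_congr_left fun _ => ?_
  rw [← @isOpen_compl_iff _ _ (zariskiSpace n)]
  change Wᶜᶜ ∈ {Z | IsAffineVariety Z} ↔ _
  rw [compl_compl]
  rfl

theorem isClosed_preimage_zeroLocus (I : Ideal (MvPolynomial (Fin n) ℂ)) :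
    @IsClosed X (inducedSpace e) (e ⁻¹' zeroLocus ℂ I) :=
  (isClosed_inducedSpace_iff e).2 ⟨zeroLocus ℂ I, ⟨(I : Set _), rfl⟩, rfl⟩

theorem closure_eq_preimage_zeroLocus (T : Set X) :
    @closure X (inducedSpace e) T = e ⁻¹' zeroLocus ℂ (vanishingIdeal ℂ (e '' T)) := by
  let _ := inducedSpace e
  apply subset_antisymm
  · refine closure_minimal (fun x hx => ?_) (isClosed_preimage_zeroLocus e _)
    exact zeroLocus_vanishingIdeal_le _ ⟨x, hx, rfl⟩
  · obtain ⟨W, hW, hWT⟩ := (isClosed_inducedSpace_iff e).1 (isClosed_closure (s := T))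
    obtain ⟨S, rfl⟩ := hW
    rw [← hWT, zeroSet_eq_zeroLocus]
    refine Set.preimage_mono (zeroLocus_anti_mono ?_)
    rw [← le_zeroLocus_iff_le_vanishingIdeal, ← zeroSet_eq_zeroLocus]
    rintro _ ⟨x, hx, rfl⟩
    exact hWT.ge (subset_closure hx)

theorem mem_closure_iff_eval {T : Set X} {x : X} :
    x ∈ @closure X (inducedSpace e) T ↔
      ∀ p : MvPolynomial (Fin n) ℂ, (∀ t ∈ T, eval (e t) p = 0) → eval (e x) p = 0 := by
  simp [closure_eq_preimage_zeroLocus, aeval_eq_eval]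

theorem vanishingIdeal_image_lt {T T' : Set X} (hT : @IsClosed X (inducedSpace e) T)
    (h : T < T') : vanishingIdeal ℂ (e '' T') < vanishingIdeal ℂ (e '' T) := by
  let _ := inducedSpace e
  refine lt_of_le_of_ne (vanishingIdeal_anti_mono (Set.image_mono h.le)) fun heq => h.not_ge ?_
  rw [← hT.closure_eq, closure_eq_preimage_zeroLocus, ← heq]
  exact fun x hx => zeroLocus_vanishingIdeal_le _ ⟨x, hx, rfl⟩

theorem isIrreducible_iff_isPrime_vanishingIdeal (T : Set X) :
    @IsIrreducible X (inducedSpace e) T ↔ (vanishingIdeal ℂ (e '' T)).IsPrime := by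
  let _ := inducedSpace e
  have hle (J : Ideal (MvPolynomial (Fin n) ℂ)) :
      T ⊆ e ⁻¹' zeroLocus ℂ J ↔ J ≤ vanishingIdeal ℂ (e '' T) := by
    rw [← le_zeroLocus_iff_le_vanishingIdeal, Set.image_subset_iff]
  have hU (I J : Ideal (MvPolynomial (Fin n) ℂ)) :
      zeroLocus ℂ I ∪ zeroLocus ℂ J = zeroLocus ℂ (I * J) := by
    ext x
    constructor
    · rintro (hx | hx)
      · exact zeroLocus_anti_mono Ideal.mul_le_left hx
      · exact zeroLocus_anti_mono Ideal.mul_le_right hx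
    · intro hx
      by_contra hcon
      simp only [Set.mem_union, not_or, mem_zeroLocus_iff, not_forall] at hcon
      obtain ⟨⟨s, hs, hsx⟩, t, ht, htx⟩ := hcon
      have h := hx _ (Ideal.mul_mem_mul hs ht)
      rw [map_mul] at h
      exact mul_ne_zero hsx htx h
  have hcl {A : Set X} (hA : IsClosed A) : ∃ I, A = e ⁻¹' zeroLocus ℂ I :=
    ⟨_, by rw [← closure_eq_preimage_zeroLocus, hA.closure_eq]⟩
  have hne : T.Nonempty ↔ vanishingIdeal ℂ (e '' T) ≠ ⊤ := by
    rw [Ne, Ideal.eq_top_iff_one, mem_vanishingIdeal_iff]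
    simp [Set.nonempty_def]
  rw [IsIrreducible, isPreirreducible_iff_isClosed_union_isClosed, hne]
  constructor
  · rintro ⟨h1, h2⟩
    refine ⟨h1, fun {a b} hab => ?_⟩
    have := h2 _ _ (isClosed_preimage_zeroLocus e (.span {a}))
      (isClosed_preimage_zeroLocus e (.span {b}))
      (by rw [← Set.preimage_union, hU, hle, Ideal.span_singleton_mul_span_singleton]; simpa using hab)
    simpa [hle] using this
  · refine fun h => ⟨h.ne_top, fun A B hA hB hAB => ?_⟩
    obtain ⟨I, rfl⟩ := hcl hA
    obtain ⟨J, rfl⟩ := hcl hB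
    rw [← Set.preimage_union, hU, hle] at hAB
    rw [hle, hle]
    exact h.mul_le.1 hAB

/-- Vanishing ideals reverse the chain into primes above `P`; inclusions stay strict because the
sets are closed. -/
theorem length_le_ringKrullDim_quotient [τ : TopologicalSpace X] (hτ : τ = inducedSpace e)
    (p : LTSeries (TopologicalSpace.IrreducibleCloseds X))
    {P : Ideal (MvPolynomial (Fin n) ℂ)} (hP : P ≤ vanishingIdeal ℂ (e '' p.last.1)) :
    (p.length : WithBot ℕ∞) ≤ ringKrullDim (MvPolynomial (Fin n) ℂ ⧸ P) := by
  subst hτ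
  let _ := inducedSpace e
  rw [ringKrullDim_quotient]
  let q : LTSeries (PrimeSpectrum.zeroLocus (P : Set (MvPolynomial (Fin n) ℂ))) :=
    { length := p.length
      toFun := fun i => ⟨⟨vanishingIdeal ℂ (e '' (p i.rev).1),
          (isIrreducible_iff_isPrime_vanishingIdeal e _).1 (p i.rev).2⟩,
        hP.trans (vanishingIdeal_anti_mono (Set.image_mono (p.monotone (Fin.le_last _))))⟩
      step := fun i => by
        refine vanishingIdeal_image_lt e (p i.succ.rev).3 ?_
        refine p.strictMono ?_
        rw [Fin.rev_lt_rev]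
        exact Fin.castSucc_lt_succ }
  exact le_iSup (fun p : LTSeries (PrimeSpectrum.zeroLocus
    (P : Set (MvPolynomial (Fin n) ℂ))) => (p.length : WithBot ℕ∞)) q

/-- If `g` vanishes on the points of the zero locus reached by `e`, then `g * f` vanishes on all of
it, so lies in `Q` by the Nullstellensatz. -/
theorem vanishingIdeal_image_preimage_zeroLocus {Q : Ideal (MvPolynomial (Fin n) ℂ)} [Q.IsPrime]
    {f : MvPolynomial (Fin n) ℂ} (hf : f ∉ Q)
    (he : ∀ y ∈ zeroLocus ℂ Q, eval y f ≠ 0 → y ∈ Set.range e) :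
    vanishingIdeal ℂ (e '' (e ⁻¹' zeroLocus ℂ Q)) = Q := by
  apply le_antisymm
  · intro g hg
    have : g * f ∈ vanishingIdeal ℂ (zeroLocus ℂ Q) := by
      intro y hy
      rw [aeval_eq_eval, map_mul]
      by_cases hfy : eval y f = 0
      · simp [hfy]
      · obtain ⟨x, rfl⟩ := he y hy hfy
        have := hg _ ⟨x, hy, rfl⟩
        rw [aeval_eq_eval] at this
        simp [this]
    rw [IsPrime.vanishingIdeal_zeroLocus] at this
    exact (Ideal.IsPrime.mem_or_mem ‹_› this).resolve_right hf
  · rw [← le_zeroLocus_iff_le_vanishingIdeal]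
    exact Set.image_preimage_subset _ _

/-- Inverting `f` keeps the dimension. The primes that survive are recovered from the traces on `X`
of their zero loci, so chains of primes give chains of irreducible closed sets. -/
theorem ringKrullDim_quotient_le_topologicalKrullDim (P : Ideal (MvPolynomial (Fin n) ℂ))
    [P.IsPrime] {f : MvPolynomial (Fin n) ℂ} (hf : f ∉ P)
    (he : ∀ y ∈ zeroLocus ℂ P, eval y f ≠ 0 → y ∈ Set.range e) :
    ringKrullDim (MvPolynomial (Fin n) ℂ ⧸ P) ≤ @topologicalKrullDim X (inducedSpace e) := by
  let _ := inducedSpace e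
  have hf' : Ideal.Quotient.mk P f ≠ 0 := by rwa [Ne, Ideal.Quotient.eq_zero_iff_mem]
  let A := Localization.Away (Ideal.Quotient.mk P f)
  let c : PrimeSpectrum A → Ideal (MvPolynomial (Fin n) ℂ) := fun q =>
    (q.asIdeal.comap (algebraMap _ A)).comap (Ideal.Quotient.mk P)
  have hcp (q) : (c q).IsPrime := inferInstanceAs (Ideal.comap _ (Ideal.comap _ _)).IsPrime
  have hcP (q) : P ≤ c q := fun x hx => by
    simp [c, Ideal.mem_comap, Ideal.Quotient.eq_zero_iff_mem.2 hx]
  have hcf (q) : f ∉ c q := fun h =>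
    q.2.ne_top (Ideal.eq_top_of_isUnit_mem _ h (IsLocalization.Away.algebraMap_isUnit _))
  have hcv (q) : vanishingIdeal ℂ (e '' (e ⁻¹' zeroLocus ℂ (c q))) = c q :=
    vanishingIdeal_image_preimage_zeroLocus e (hcf q) fun y hy =>
      he y (zeroLocus_anti_mono (hcP q) hy)
  have hcm {q q'} : c q ≤ c q' ↔ q ≤ q' := by
    rw [Ideal.comap_le_comap_iff_of_surjective _ Ideal.Quotient.mk_surjective]
    exact (IsLocalization.orderEmbedding (.powers (Ideal.Quotient.mk P f)) A).le_iff_le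
  rw [← ringKrullDim_localizationAway ℂ hf', ringKrullDim, ← Order.krullDim_orderDual]
  refine Order.krullDim_le_of_strictMono (fun q : (PrimeSpectrum A)ᵒᵈ =>
    (⟨e ⁻¹' zeroLocus ℂ (c q.ofDual), (isIrreducible_iff_isPrime_vanishingIdeal e _).2
      (by rw [hcv]; exact hcp _), isClosed_preimage_zeroLocus e _⟩ :
      TopologicalSpace.IrreducibleCloseds X)) fun q q' h => ?_
  have h' : q'.ofDual < q.ofDual := h
  refine lt_of_le_not_ge (fun x hx => zeroLocus_anti_mono (hcm.2 h'.le) hx) fun hge => ?_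
  refine h'.not_ge (hcm.1 ?_)
  rw [← hcv, ← hcv q'.ofDual]
  exact vanishingIdeal_anti_mono (Set.image_mono hge)

end Topology

/-- The image of a morphism from an irreducible affine variety contains a nonempty open subset of
its closure. -/
theorem exists_basicOpen_subset_image (P : Ideal (MvPolynomial (Fin m) ℂ)) [P.IsPrime]
    (φ : MvPolynomial (Fin n) ℂ →ₐ[ℂ] MvPolynomial (Fin m) ℂ) :
    ∃ f ∉ P.comap φ, ∀ y ∈ zeroLocus ℂ (P.comap φ), eval y f ≠ 0 →
      ∃ x ∈ zeroLocus ℂ P, y = fun i => eval x (φ (X i)) := by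
  let ψ : (MvPolynomial (Fin n) ℂ ⧸ P.comap φ) →ₐ[ℂ] (MvPolynomial (Fin m) ℂ ⧸ P) :=
    Ideal.quotientMapₐ P φ le_rfl
  have hψ : Function.Injective ψ := Ideal.quotientMap_injective
  have hft : ψ.toRingHom.FiniteType :=
    .of_comp_finiteType (f := algebraMap ℂ _) (by
      have h : ψ.toRingHom.comp (algebraMap ℂ _) = algebraMap ℂ _ := ψ.comp_algebraMap
      rw [h, RingHom.finiteType_algebraMap]
      infer_instance)
  obtain ⟨a, ha, hr⟩ := exists_basicOpen_subset_range_comap hft hψ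
  obtain ⟨f, rfl⟩ := Ideal.Quotient.mk_surjective a
  refine ⟨f, fun h => ha (Ideal.Quotient.eq_zero_iff_mem.2 h), fun y hy hfy => ?_⟩
  let My : Ideal (MvPolynomial (Fin n) ℂ) := vanishingIdeal ℂ {y}
  have hMy : P.comap φ ≤ My := by
    rw [← le_zeroLocus_iff_le_vanishingIdeal]; simpa using hy
  have hcomap : (My.map (Ideal.Quotient.mk (P.comap φ))).comap (Ideal.Quotient.mk (P.comap φ)) = My := by
    rw [Ideal.comap_map_of_surjective _ Ideal.Quotient.mk_surjective, ← RingHom.ker_eq_comap_bot,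
      Ideal.mk_ker, sup_eq_left.2 hMy]
  have hprime : (My.map (Ideal.Quotient.mk (P.comap φ))).IsPrime :=
    Ideal.map_isPrime_of_surjective Ideal.Quotient.mk_surjective (by rwa [Ideal.mk_ker])
  obtain ⟨q, hq⟩ := hr (show (⟨_, hprime⟩ : PrimeSpectrum _) ∈ _ from fun h => hfy (by
    have h' : f ∈ My := by rw [← hcomap]; exact h
    simpa [aeval_eq_eval] using h' y rfl))
  let q' := q.asIdeal.comap (Ideal.Quotient.mk P)
  have hq' : q'.IsPrime := inferInstance
  have hPq : P ≤ q' := fun x hx => by simp [q', Ideal.mem_comap, Ideal.Quotient.eq_zero_iff_mem.2 hx]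
  have hMq {p : MvPolynomial (Fin n) ℂ} (hp : p ∈ My) : φ p ∈ q' := by
    have h : Ideal.Quotient.mk (P.comap φ) p ∈ (PrimeSpectrum.comap ψ.toRingHom q).asIdeal := by
      rw [hq]
      exact Ideal.mem_map_of_mem _ hp
    exact h
  -- The prime `q` over the point `y` need not be maximal; any zero `x` of it maps to `y`, since `φ
  -- (X i - C (y i)) ∈ q'`.
  obtain ⟨x, hx⟩ : (zeroLocus ℂ q').Nonempty := by
    rw [Set.nonempty_iff_ne_empty]
    intro h
    have h' := IsPrime.vanishingIdeal_zeroLocus (K := ℂ) q'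
    rw [h, vanishingIdeal_empty] at h'
    exact hq'.ne_top h'.symm
  refine ⟨x, zeroLocus_anti_mono hPq hx, funext fun i => ?_⟩
  have h := hx _ (hMq (p := X i - C (y i)) (by simp [My]))
  rw [aeval_eq_eval, map_sub, map_sub, sub_eq_zero, algHom_C, algebraMap_eq] at h
  simpa using h.symm

end AffineGIT

/-! ### Orbits, their closures and their dimensions -/

namespace AffineGIT

open MvPolynomial

variable {m n : ℕ}

theorem mem_coordinateRing_iff {Z : Set (Fin n → ℂ)} {f : Z → ℂ} :
    f ∈ coordinateRing Z ↔ ∃ p : MvPolynomial (Fin n) ℂ, ∀ z : Z, f z = eval z.1 p := by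
  have h (p : MvPolynomial (Fin n) ℂ) (z : Z) :
      aeval (R := ℂ) (fun (i : Fin n) (z : Z) => z.1 i) p z = eval z.1 p := by
    have : (Pi.evalAlgHom ℂ (fun _ : Z => ℂ) z).comp
        (aeval (R := ℂ) (fun (i : Fin n) (z : Z) => z.1 i)) = aeval z.1 := by
      ext i; simp
    simpa [aeval_eq_eval] using congrArg (fun ψ => ψ p) this
  simp only [coordinateRing, AlgHom.mem_range, funext_iff, h]
  exact exists_congr fun p => forall_congr' fun z => eq_comm

theorem IsAffineVariety.exists_eq_zeroLocus {Z : Set (Fin n → ℂ)} (hZ : IsAffineVariety Z) :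
    ∃ I : Ideal (MvPolynomial (Fin n) ℂ), Z = zeroLocus ℂ I := by
  obtain ⟨S, rfl⟩ := hZ
  exact ⟨_, zeroSet_eq_zeroLocus S⟩

section Action

variable {G : Set (Fin m → ℂ)} [Group G] {Z : Set (Fin n → ℂ)} [MulAction G Z]

theorem IsAlgebraicAction.exists_eval_smul_eq (hact : IsAlgebraicAction G Z)
    (p : MvPolynomial (Fin n) ℂ) :
    IsRegularOnProd fun (g : G) (z : Z) => eval (g • z).1 p := by
  choose q hq using hact
  refine ⟨aeval q p, fun g z => ?_⟩
  have : (aeval (Sum.elim g.1 z.1)).comp (aeval q) = aeval (R := ℂ) (g • z).1 := by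
    ext i; simp [aeval_eq_eval, hq]
  simpa [aeval_eq_eval] using (congrArg (fun ψ => ψ p) this).symm

theorem IsAlgebraicAction.exists_orbitMap (hact : IsAlgebraicAction G Z) (z : Z) :
    ∃ φ : MvPolynomial (Fin n) ℂ →ₐ[ℂ] MvPolynomial (Fin m) ℂ,
      ∀ (g : G) (p : MvPolynomial (Fin n) ℂ), eval g.1 (φ p) = eval (g • z).1 p := by
  choose q hq using hact
  refine ⟨aeval fun i => aeval (Sum.elim X fun j => C (z.1 j)) (q i), fun g p => ?_⟩
  have h (i) : eval g.1 (aeval (Sum.elim X fun j => C (z.1 j)) (q i)) = (g • z).1 i := by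
    have : (aeval (R := ℂ) g.1).comp (aeval (Sum.elim X fun j => C (z.1 j))) =
        aeval (R := ℂ) (Sum.elim g.1 z.1) := by
      ext (i | i) <;> simp
    refine Eq.trans ?_ (hq i g z).symm
    simpa only [aeval_eq_eval, AlgHom.comp_apply] using congrArg (fun ψ => ψ (q i)) this
  have : (aeval (R := ℂ) g.1).comp (aeval fun i => aeval (Sum.elim X fun j => C (z.1 j)) (q i)) =
      aeval (R := ℂ) (g • z).1 := by
    ext i
    rw [AlgHom.comp_apply, aeval_X, aeval_X, aeval_eq_eval]
    exact h i
  simpa [aeval_eq_eval] using congrArg (fun ψ => ψ p) this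

/-- Regular functions on a product split as finite sums of products of regular functions. -/
theorem IsRegularOnProd.exists_sum_mul {G : Set (Fin m → ℂ)} {Z : Set (Fin n → ℂ)}
    {f : G → Z → ℂ} (hf : IsRegularOnProd f) :
    ∃ (ι : Type) (_ : Fintype ι) (a : ι → G → ℂ) (b : ι → Z → ℂ),
      (∀ i, a i ∈ coordinateRing G) ∧ (∀ i, b i ∈ coordinateRing Z) ∧
      ∀ g z, f g z = ∑ i, a i g * b i z := by
  obtain ⟨q, hq⟩ := hf
  refine ⟨q.support, inferInstance, fun d g => coeff d.1 q * ∏ i, g.1 i ^ d.1 (.inl i),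
    fun d z => ∏ i, z.1 i ^ d.1 (.inr i), fun d => ?_, fun d => ?_, fun g z => ?_⟩
  · exact mem_coordinateRing_iff.2 ⟨C (coeff d.1 q) * ∏ i, X i ^ d.1 (.inl i), by simp⟩
  · exact mem_coordinateRing_iff.2 ⟨∏ i, X i ^ d.1 (.inr i), by simp⟩
  · rw [hq, eval_eq', ← Finset.sum_coe_sort]
    simp [Fintype.prod_sum_type, mul_assoc]

variable (G) in
/-- The ideal of polynomials vanishing on the orbit of `z`. -/
noncomputable def orbitIdeal (z : Z) : Ideal (MvPolynomial (Fin n) ℂ) :=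
  vanishingIdeal ℂ (Subtype.val '' MulAction.orbit G z)

theorem mem_orbitIdeal_iff {z : Z} {p : MvPolynomial (Fin n) ℂ} :
    p ∈ orbitIdeal G z ↔ ∀ g : G, eval (g • z).1 p = 0 := by
  simp only [orbitIdeal, MulAction.orbit, mem_vanishingIdeal_iff, Set.forall_mem_image,
    Set.forall_mem_range, aeval_eq_eval]

theorem mem_orbitClosure_iff {z y : Z} :
    y ∈ orbitClosure G z ↔ ∀ p ∈ orbitIdeal G z, eval y.1 p = 0 := by
  refine (mem_closure_iff_eval Subtype.val).trans (forall_congr' fun p => ?_)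
  rw [mem_orbitIdeal_iff, MulAction.orbit, Set.forall_mem_range]

theorem mem_orbitClosure_self (z : Z) : z ∈ orbitClosure G z :=
  mem_orbitClosure_iff.2 fun p hp => by simpa using mem_orbitIdeal_iff.1 hp 1

theorem orbitIdeal_smul (g : G) (z : Z) : orbitIdeal G (g • z) = orbitIdeal G z := by
  rw [orbitIdeal, orbitIdeal, MulAction.orbit_smul]

/-- For fixed `g`, translation by `g` is polynomial on `Z`, so polynomials vanishing on an orbit are
stable under translation. -/
theorem IsAlgebraicAction.mem_orbitClosure_iff_orbitIdeal_le (hact : IsAlgebraicAction G Z)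
    {z y : Z} : y ∈ orbitClosure G z ↔ orbitIdeal G z ≤ orbitIdeal G y := by
  rw [mem_orbitClosure_iff]
  refine ⟨fun h p hp => mem_orbitIdeal_iff.2 fun g => ?_, fun h p hp => ?_⟩
  · obtain ⟨a, ha⟩ : ∃ a : MvPolynomial (Fin n) ℂ, ∀ z : Z, eval (g • z).1 p = eval z.1 a := by
      obtain ⟨ι, _, a, b, -, hb, hab⟩ := (hact.exists_eval_smul_eq p).exists_sum_mul
      refine (mem_coordinateRing_iff (f := fun z : Z => eval (g • z).1 p)).1 ?_
      have : (fun z : Z => eval (g • z).1 p) = ∑ i, a i g • b i := by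
        ext z; simp [hab]
      rw [this]
      exact sum_mem fun i _ => Subalgebra.smul_mem _ (hb i) _
    rw [ha]
    refine h a (mem_orbitIdeal_iff.2 fun k => ?_)
    rw [← ha, smul_smul]
    exact mem_orbitIdeal_iff.1 hp _
  · simpa using mem_orbitIdeal_iff.1 (h hp) 1

theorem IsAlgebraicAction.orbitClosure_subset (hact : IsAlgebraicAction G Z) {z y : Z}
    (h : y ∈ orbitClosure G z) : orbitClosure G y ⊆ orbitClosure G z := fun x hx => by
  rw [hact.mem_orbitClosure_iff_orbitIdeal_le] at *
  exact h.trans hx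

theorem IsAlgebraicAction.orbit_subset_orbitClosure (hact : IsAlgebraicAction G Z) {z y : Z}
    (h : y ∈ orbitClosure G z) : MulAction.orbit G y ⊆ orbitClosure G z := by
  rintro _ ⟨g, rfl⟩
  rw [hact.mem_orbitClosure_iff_orbitIdeal_le] at *
  exact h.trans (orbitIdeal_smul g y).ge

theorem orbitIdeal_ne_top (z : Z) : orbitIdeal G z ≠ ⊤ := by
  rw [Ne, Ideal.eq_top_iff_one, mem_orbitIdeal_iff]
  simp

/-- Every prime containing the ideal of an orbit contains a prime over that ideal whose zero locus
has a nonempty open subset inside the orbit. -/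
theorem IsAlgebraicAction.exists_isPrime_basicOpen_subset_orbit (hG : IsAffineVariety G)
    (hact : IsAlgebraicAction G Z) (z : Z) {Q : Ideal (MvPolynomial (Fin n) ℂ)} [Q.IsPrime]
    (hQ : orbitIdeal G z ≤ Q) :
    ∃ P : Ideal (MvPolynomial (Fin n) ℂ), P.IsPrime ∧ orbitIdeal G z ≤ P ∧ P ≤ Q ∧
      ∃ f ∉ P, ∀ y ∈ zeroLocus ℂ P, eval y f ≠ 0 → ∃ g : G, y = (g • z).1 := by
  obtain ⟨φ, hφ⟩ := hact.exists_orbitMap z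
  obtain ⟨I, hI⟩ := hG.exists_eq_zeroLocus
  have hfin := I.finite_minimalPrimes_of_isNoetherianRing
  -- `G` may be reducible. The orbit is the union of the images of its finitely many components, so
  -- their pulled-back primes intersect inside `Q`, and one of them is contained in `Q`.
  have hle : (hfin.toFinset.inf fun P => P.comap φ) ≤ Q := by
    intro p hp
    refine hQ (mem_orbitIdeal_iff.2 fun g => ?_)
    rw [← hφ]
    have hg : I ≤ vanishingIdeal ℂ {g.1} := by
      rw [← le_zeroLocus_iff_le_vanishingIdeal, ← hI]; simp
    obtain ⟨P, hP, hPg⟩ := Ideal.exists_minimalPrimes_le hg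
    have : φ p ∈ P := (Submodule.mem_finsetInf.1 hp) P (hfin.mem_toFinset.2 hP)
    simpa [aeval_eq_eval] using hPg this
  obtain ⟨P, hP, hPQ⟩ := (Ideal.IsPrime.inf_le' ‹_›).1 hle
  rw [hfin.mem_toFinset] at hP
  have := hP.1.1
  have hsub : zeroLocus ℂ P ⊆ G := hI ▸ zeroLocus_anti_mono hP.1.2
  refine ⟨P.comap φ, inferInstance, fun p hp => ?_, hPQ, ?_⟩
  · rw [Ideal.mem_comap, ← IsPrime.vanishingIdeal_zeroLocus (K := ℂ) P]
    intro x hx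
    rw [aeval_eq_eval]
    exact (hφ ⟨x, hsub hx⟩ p).trans (mem_orbitIdeal_iff.1 hp _)
  · obtain ⟨f, hf, hfy⟩ := exists_basicOpen_subset_image P φ
    refine ⟨f, hf, fun y hy h => ?_⟩
    obtain ⟨x, hx, rfl⟩ := hfy y hy h
    exact ⟨⟨x, hsub hx⟩, funext fun i => by rw [hφ ⟨x, hsub hx⟩ (X i), eval_X]⟩

/-- Both orbits contain a nonempty open part of the same irreducible component of their common
closure, so they meet. -/
theorem IsAlgebraicAction.mem_orbit_of_orbitIdeal_eq (hG : IsAffineVariety G)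
    (hact : IsAlgebraicAction G Z) {z w : Z} (h : orbitIdeal G z = orbitIdeal G w) :
    w ∈ MulAction.orbit G z := by
  obtain ⟨Q, hQ⟩ := Ideal.nonempty_minimalPrimes (orbitIdeal_ne_top (G := G) z)
  have := hQ.1.1
  obtain ⟨P, hP, hzP, hPQ, f, hf, hfy⟩ := hact.exists_isPrime_basicOpen_subset_orbit hG z hQ.1.2
  obtain ⟨P', hP', hwP', hPQ', f', hf', hfy'⟩ :=
    hact.exists_isPrime_basicOpen_subset_orbit hG w (h ▸ hQ.1.2)
  obtain rfl : P = Q := le_antisymm hPQ (hQ.2 ⟨hP, hzP⟩ hPQ)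
  obtain rfl : P' = P := le_antisymm hPQ' (hQ.2 ⟨hP', h ▸ hwP'⟩ hPQ')
  have hff : f * f' ∉ P' := fun hm => (hP.mem_or_mem hm).elim hf hf'
  rw [← IsPrime.vanishingIdeal_zeroLocus (K := ℂ) P', mem_vanishingIdeal_iff] at hff
  push Not at hff
  obtain ⟨y, hy, hne⟩ := hff
  rw [aeval_eq_eval] at hne
  simp only [map_mul, ne_eq, mul_eq_zero, not_or] at hne
  obtain ⟨g, hg⟩ := hfy y hy hne.1
  obtain ⟨k, hk⟩ := hfy' y hy hne.2
  have : g • z = k • w := Subtype.ext (hg.symm.trans hk)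
  exact ⟨k⁻¹ * g, by simp [mul_smul, this]⟩

theorem IsAlgebraicAction.exists_isClosedOrbitIn (hG : IsAffineVariety G)
    (hact : IsAlgebraicAction G Z) (z : Z) : ∃ C, IsClosedOrbitIn G z C := by
  -- A maximal orbit ideal means a minimal orbit closure inside `Δ(z)`.
  obtain ⟨J, ⟨w, hw, rfl⟩, hmax⟩ := WellFounded.has_min
    (wellFounded_gt (α := Ideal (MvPolynomial (Fin n) ℂ)))
    {J | ∃ w ∈ orbitClosure G z, orbitIdeal G w = J} ⟨_, z, mem_orbitClosure_self z, rfl⟩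
  have hcl : orbitClosure G w = MulAction.orbit G w := by
    refine subset_antisymm (fun y hy => ?_)
      (hact.orbit_subset_orbitClosure (mem_orbitClosure_self w))
    refine hact.mem_orbit_of_orbitIdeal_eq hG (eq_of_le_of_not_lt
      (hact.mem_orbitClosure_iff_orbitIdeal_le.1 hy)
      (hmax _ ⟨y, hact.orbitClosure_subset hw hy, rfl⟩))
  refine ⟨MulAction.orbit G w, ⟨w, rfl⟩, ?_, hact.orbit_subset_orbitClosure hw⟩
  rw [← hcl]
  exact @isClosed_closure Z (zariski Z) _

theorem zariskiDim_eq (W : Set Z) : zariskiDim W =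
    @topologicalKrullDim W (inducedSpace fun x : W => x.1.1) := by
  rw [zariskiDim]
  congr 1
  exact induced_compose

/-- The top of a chain in `C` lies in an irreducible closed set in which the orbit of `w` contains a
nonempty open part, so that set bounds the length by the dimension of the orbit. -/
theorem IsAlgebraicAction.zariskiDim_le_zariskiDim_orbit (hG : IsAffineVariety G)
    (hact : IsAlgebraicAction G Z) {w : Z} {C : Set Z} (hC : C ⊆ orbitClosure G w) :
    zariskiDim C ≤ zariskiDim (MulAction.orbit G w) := by
  rw [zariskiDim_eq, zariskiDim_eq]
  let _ := inducedSpace fun x : C => x.1.1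
  refine iSup_le fun p => ?_
  have hQ := (isIrreducible_iff_isPrime_vanishingIdeal (fun x : C => x.1.1) _).1 p.last.2
  obtain ⟨P, hP, -, hPQ, f, hf, hfy⟩ := hact.exists_isPrime_basicOpen_subset_orbit hG w
    (Q := vanishingIdeal ℂ ((fun x : C => x.1.1) '' p.last.1)) (by
      rintro q hq _ ⟨x, -, rfl⟩
      rw [aeval_eq_eval]
      exact mem_orbitClosure_iff.1 (hC x.2) q hq)
  refine (length_le_ringKrullDim_quotient _ rfl p hPQ).trans
    (ringKrullDim_quotient_le_topologicalKrullDim _ P hf fun y hy h => ?_)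
  obtain ⟨g, rfl⟩ := hfy y hy h
  exact ⟨⟨g • w, g, rfl⟩, rfl⟩

end Action

end AffineGIT

/-! ### The Nagata hypothesis and separation by invariants -/

namespace AffineGIT

open MvPolynomial

variable {m n : ℕ} {G : Set (Fin m → ℂ)} [Group G]

theorem IsAlgebraicRep.toRepresentation {M : Type} [AddCommGroup M] [Module ℂ M]
    {ρ : Representation ℂ G M} (hρ : IsAlgebraicRep G ρ) (V : Subrepresentation ρ) :
    IsAlgebraicRep G V.toRepresentation := by
  intro v ξ
  obtain ⟨ξ', rfl⟩ := LinearMap.exists_extend ξ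
  exact hρ v ξ'

/-- Under the Nagata hypothesis, a nonzero invariant functional on an algebraic representation does
not vanish on all invariant vectors. -/
theorem NagataHypothesis.exists_invariant (hN : NagataHypothesis G) (d : ℕ) :
    ∀ (M : Type) [AddCommGroup M] [Module ℂ M] [FiniteDimensional ℂ M]
      (ρ : Representation ℂ G M), IsAlgebraicRep G ρ → Module.finrank ℂ M = d →
      ∀ l : Module.Dual ℂ M, l ≠ 0 → (∀ g x, l (ρ g x) = l x) →
      ∃ v, (∀ g, ρ g v = v) ∧ l v ≠ 0 := by
  induction d using Nat.strong_induction_on with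
  | _ d ih =>
  intro M _ _ _ ρ hρ hd l hl hinv
  have hsurj : Function.Surjective l := LinearMap.surjective hl
  obtain ⟨H, P, hHP, hH, hHinv, hP⟩ := hN M ρ hρ (LinearMap.ker l)
    (by rw [(l.quotKerEquivOfSurjective hsurj).finrank_eq, Module.finrank_self])
    (fun g x hx => by rw [LinearMap.mem_ker] at *; rw [hinv, hx])
    (fun g x => by rw [LinearMap.mem_ker, map_sub, hinv, sub_self])
  -- The trivial summand may lie in the kernel of `l`; then `l` is nonzero on `H`, of smaller
  -- dimension, and induction applies.
  by_cases hPl : ∃ x ∈ P, l x ≠ 0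
  · obtain ⟨x, hx, hlx⟩ := hPl
    exact ⟨x, fun g => hP g x hx, hlx⟩
  · push Not at hPl
    let V : Subrepresentation ρ := ⟨H, fun g x hx => hHinv g x hx⟩
    have hrank := H.finrank_quotient_add_finrank
    have hlH : l.comp H.subtype ≠ 0 := fun h0 => hl (by
      ext x
      have hx : x ∈ H ⊔ P := by rw [hHP.sup_eq_top]; trivial
      obtain ⟨a, ha, b, hb, rfl⟩ := Submodule.mem_sup.1 hx
      rw [map_add, hPl b hb, add_zero]
      exact LinearMap.congr_fun h0 ⟨a, ha⟩)
    obtain ⟨v, hv, hlv⟩ := ih (Module.finrank ℂ H) (by omega) H V.toRepresentation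
      (hρ.toRepresentation V) rfl (l.comp H.subtype) hlH (fun g x => hinv g x)
    exact ⟨v, fun g => congrArg Subtype.val (hv g), hlv⟩

variable {Z : Set (Fin n → ℂ)} [MulAction G Z]

variable (G Z) in
/-- The representation of `G` on functions by translation. -/
noncomputable def translation : Representation ℂ G (Z → ℂ) where
  toFun g := LinearMap.funLeft ℂ ℂ fun z => g⁻¹ • z
  map_one' := by ext; simp [LinearMap.funLeft]
  map_mul' g h := by ext; simp [LinearMap.funLeft, mul_smul]

@[simp] theorem translation_apply (g : G) (f : Z → ℂ) (z : Z) :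
    translation G Z g f z = f (g⁻¹ • z) := rfl

variable (G) in
/-- The subrepresentation generated by a function. -/
noncomputable def translates (f : Z → ℂ) : Subrepresentation (translation G Z) where
  toSubmodule := Submodule.span ℂ (Set.range fun g => translation G Z g f)
  apply_mem_toSubmodule g v hv := by
    have h : Submodule.span ℂ (Set.range fun g => translation G Z g f) ≤
        (Submodule.span ℂ (Set.range fun g => translation G Z g f)).comap (translation G Z g) := by
      rw [Submodule.span_le]
      rintro _ ⟨h, rfl⟩
      exact Submodule.subset_span ⟨g * h, by simp only [map_mul]; rfl⟩
    exact h hv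

/-- The translates of a regular function are spanned by finitely many regular functions, with
regular coefficients. -/
theorem IsAlgebraicAction.exists_translation_eq_sum (hG : IsAlgebraicGroup G)
    (hact : IsAlgebraicAction G Z) {f : Z → ℂ} (hf : f ∈ coordinateRing Z) :
    ∃ (ι : Type) (_ : Fintype ι) (a : ι → G → ℂ) (b : ι → Z → ℂ),
      (∀ i, a i ∈ coordinateRing G) ∧ (∀ i, b i ∈ coordinateRing Z) ∧
      ∀ g, translation G Z g f = ∑ i, a i g • b i := by
  obtain ⟨p, hp⟩ := mem_coordinateRing_iff.1 hf
  obtain ⟨ι, _, a, b, ha, hb, hab⟩ := (hact.exists_eval_smul_eq p).exists_sum_mul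
  -- Translation acts through `g⁻¹`, so regularity of the coefficients uses the inverse morphism.
  refine ⟨ι, inferInstance, fun i g => a i g⁻¹, b, fun i => ?_, hb, fun g => ?_⟩
  · obtain ⟨q, hq⟩ := mem_coordinateRing_iff.1 (ha i)
    choose r hr using fun j => mem_coordinateRing_iff.1 (hG.regular_inv j)
    refine mem_coordinateRing_iff.2 ⟨bind₁ r q, fun g => ?_⟩
    refine (hq g⁻¹).trans ?_
    have h := aeval_bind₁ g.1 r q
    simp only [aeval_eq_eval, ← hr] at h
    exact h.symm
  · ext z
    simp [hp, hab]

theorem translates_le_coordinateRing (hG : IsAlgebraicGroup G) (hact : IsAlgebraicAction G Z)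
    {f : Z → ℂ} (hf : f ∈ coordinateRing Z) :
    (translates G f).toSubmodule ≤ Subalgebra.toSubmodule (coordinateRing Z) := by
  obtain ⟨ι, _, a, b, -, hb, hab⟩ := hact.exists_translation_eq_sum hG hf
  refine Submodule.span_le.2 ?_
  rintro _ ⟨g, rfl⟩
  simp only [hab]
  exact sum_mem fun i _ => Submodule.smul_mem _ _ (hb i)

theorem finiteDimensional_translates (hG : IsAlgebraicGroup G) (hact : IsAlgebraicAction G Z)
    {f : Z → ℂ} (hf : f ∈ coordinateRing Z) :
    FiniteDimensional ℂ (translates G f).toSubmodule := by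
  obtain ⟨ι, _, a, b, -, -, hab⟩ := hact.exists_translation_eq_sum hG hf
  have : FiniteDimensional ℂ (Submodule.span ℂ (Set.range b)) :=
    FiniteDimensional.span_of_finite ℂ (Set.finite_range b)
  refine Submodule.finiteDimensional_of_le (S₂ := Submodule.span ℂ (Set.range b))
    (Submodule.span_le.2 ?_)
  rintro _ ⟨g, rfl⟩
  simp only [hab]
  exact sum_mem fun i _ => Submodule.smul_mem _ _ (Submodule.subset_span ⟨i, rfl⟩)

/-- The functional is extended to all functions because the `b i` need not lie in the span of the
translates; the coefficient is then a combination of the `a i`. -/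
theorem isAlgebraicRep_translates (hG : IsAlgebraicGroup G) (hact : IsAlgebraicAction G Z)
    {f : Z → ℂ} (hf : f ∈ coordinateRing Z) :
    IsAlgebraicRep G (translates G f).toRepresentation := by
  intro v ξ
  obtain ⟨ξ', rfl⟩ := LinearMap.exists_extend ξ
  obtain ⟨ι, _, a, b, ha, -, hab⟩ :=
    hact.exists_translation_eq_sum hG (translates_le_coordinateRing hG hact hf v.2)
  have h : (fun g : G => (ξ'.comp (translates G f).toSubmodule.subtype)
      ((translates G f).toRepresentation g v)) = ∑ i, ξ' (b i) • a i := by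
    ext g
    change ξ' (translation G Z g v.1) = _
    simp [hab, mul_comm]
  rw [h]
  exact sum_mem fun i _ => Subalgebra.smul_mem _ (ha i) _

/-- A maximal ideal containing both orbit ideals would be a common point of the closures, so the
ideals sum to the unit ideal; split 1. -/
theorem exists_eq_zero_and_eq_one_of_not_closuresMeet (hZ : IsAffineVariety Z) {z₁ z₂ : Z}
    (h : ¬ ClosuresMeet G z₁ z₂) : ∃ f ∈ coordinateRing Z,
      (∀ g : G, f (g • z₁) = 0) ∧ ∀ g : G, f (g • z₂) = 1 := by
  have htop : orbitIdeal G z₁ ⊔ orbitIdeal G z₂ = ⊤ := by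
    by_contra hne
    obtain ⟨J, hJ, hle⟩ := Ideal.exists_le_maximal _ hne
    obtain ⟨x, rfl⟩ := isMaximal_iff_eq_vanishingIdeal_singleton.1 hJ
    have hx (z : Z) (hz : orbitIdeal G z ≤ vanishingIdeal ℂ {x}) :
        ∀ p ∈ orbitIdeal G z, eval x p = 0 := fun p hp => by
      simpa [aeval_eq_eval] using hz hp
    have h1 := hx z₁ (le_sup_left.trans hle)
    have hxZ : x ∈ Z := by
      obtain ⟨S, rfl⟩ := hZ
      exact fun p hp => h1 p (mem_orbitIdeal_iff.2 fun g => (g • z₁).2 p hp)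
    exact h ⟨⟨x, hxZ⟩, mem_orbitClosure_iff.2 h1,
      mem_orbitClosure_iff.2 (hx z₂ (le_sup_right.trans hle))⟩
  obtain ⟨p, hp, q, hq, hpq⟩ := Submodule.mem_sup.1 ((Ideal.eq_top_iff_one _).1 htop)
  refine ⟨fun z => eval z.1 p, mem_coordinateRing_iff.2 ⟨p, fun _ => rfl⟩,
    mem_orbitIdeal_iff.1 hp, fun g => ?_⟩
  have := congrArg (eval (g • z₂).1) hpq
  rwa [map_add, mem_orbitIdeal_iff.1 hq, add_zero, map_one] at this

theorem exists_invariant_ne (hG : IsAlgebraicGroup G) (hN : NagataHypothesis G)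
    (hZ : IsAffineVariety Z) (hact : IsAlgebraicAction G Z) {z₁ z₂ : Z}
    (h : ¬ ClosuresMeet G z₁ z₂) : ∃ f ∈ invariantRing G Z, f z₁ ≠ f z₂ := by
  obtain ⟨f, hf, hf1, hf2⟩ := exists_eq_zero_and_eq_one_of_not_closuresMeet hZ h
  have := finiteDimensional_translates hG hact hf
  let V := translates G f
  let ev (z : Z) : Module.Dual ℂ (Z → ℂ) := LinearMap.proj z
  have hspan {l : Module.Dual ℂ (Z → ℂ)} (hl : ∀ g, l (translation G Z g f) = 0) :
      ∀ v ∈ V.toSubmodule, l v = 0 := by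
    have : V.toSubmodule ≤ LinearMap.ker l := by
      refine Submodule.span_le.2 ?_
      rintro _ ⟨g, rfl⟩
      exact hl g
    exact this
  have hfV : f ∈ V.toSubmodule := Submodule.subset_span ⟨1, by simp⟩
  obtain ⟨v, hv, hv2⟩ := hN.exists_invariant _ V.toSubmodule V.toRepresentation
    (isAlgebraicRep_translates hG hact hf) rfl ((ev z₂).comp V.toSubmodule.subtype)
    (fun h0 => by
      have h1 : f z₂ = 0 := LinearMap.congr_fun h0 ⟨f, hfV⟩
      have h2 := hf2 1
      rw [one_smul, h1] at h2
      exact zero_ne_one h2)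
    (fun g x => by
      -- Evaluation at `z₂` is invariant only on `V`: `f` is constant on the orbit of `z₂`, hence so
      -- is every combination of its translates.
      have h := hspan (l := ev (g⁻¹ • z₂) - ev z₂) (fun k => by
        change f (k⁻¹ • g⁻¹ • z₂) - f (k⁻¹ • z₂) = 0
        rw [smul_smul, hf2, hf2, sub_self]) x.1 x.2
      exact sub_eq_zero.1 h)
  have hv1 : v.1 z₁ = 0 := hspan (l := ev z₁) (fun g => hf1 g⁻¹) v.1 v.2
  refine ⟨v.1, ⟨translates_le_coordinateRing hG hact hf v.2, fun g z => ?_⟩, ?_⟩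
  · have := congrFun (congrArg Subtype.val (hv g⁻¹)) z
    simpa using (show v.1 ((g⁻¹)⁻¹ • z) = v.1 z from this)
  · rw [hv1]
    exact fun h => hv2 h.symm

theorem eq_of_mem_orbitClosure {f : Z → ℂ} (hf : f ∈ invariantRing G Z) {z y : Z}
    (h : y ∈ orbitClosure G z) : f y = f z := by
  obtain ⟨p, hp⟩ := mem_coordinateRing_iff.1 hf.1
  have := mem_orbitClosure_iff.1 h (p - C (f z)) (mem_orbitIdeal_iff.2 fun g => by
    rw [map_sub, eval_C, ← hp, hf.2, sub_self])
  rwa [map_sub, eval_C, ← hp, sub_eq_zero] at this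

theorem closuresMeet_iff (hG : IsAlgebraicGroup G) (hN : NagataHypothesis G)
    (hZ : IsAffineVariety Z) (hact : IsAlgebraicAction G Z) (z₁ z₂ : Z) :
    ClosuresMeet G z₁ z₂ ↔ ∀ f ∈ invariantRing G Z, f z₁ = f z₂ := by
  constructor
  · rintro ⟨y, h1, h2⟩ f hf
    rw [← eq_of_mem_orbitClosure hf h1, eq_of_mem_orbitClosure hf h2]
  · intro h
    by_contra hcon
    obtain ⟨f, hf, hne⟩ := exists_invariant_ne hG hN hZ hact hcon
    exact hne (h f hf)

theorem IsClosedOrbitIn.eq (hG : IsAlgebraicGroup G) (hN : NagataHypothesis G)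
    (hZ : IsAffineVariety Z) (hact : IsAlgebraicAction G Z) {z : Z} {C C' : Set Z}
    (hC : IsClosedOrbitIn G z C) (hC' : IsClosedOrbitIn G z C') : C' = C := by
  obtain ⟨⟨w, rfl⟩, hcl, hsub⟩ := hC
  obtain ⟨⟨w', rfl⟩, hcl', hsub'⟩ := hC'
  obtain ⟨y, hy, hy'⟩ := (closuresMeet_iff hG hN hZ hact w w').2 fun f hf => by
    rw [eq_of_mem_orbitClosure hf (hsub (MulAction.mem_orbit_self w)),
      eq_of_mem_orbitClosure hf (hsub' (MulAction.mem_orbit_self w'))]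
  have h1 : y ∈ MulAction.orbit G w := (@IsClosed.closure_eq _ (zariski Z) _ hcl).le hy
  have h2 : y ∈ MulAction.orbit G w' := (@IsClosed.closure_eq _ (zariski Z) _ hcl').le hy'
  rw [← MulAction.orbit_eq_iff.2 h1, MulAction.orbit_eq_iff.2 h2]

end AffineGIT

theorem mainTheorem10 {m n : ℕ}
    (G : Set (Fin m → ℂ)) [Group G] (hG : AffineGIT.IsAlgebraicGroup G)
    (hN : AffineGIT.NagataHypothesis G)
    (Z : Set (Fin n → ℂ)) (hZ : AffineGIT.IsAffineVariety Z)
    [MulAction G Z] (hact : AffineGIT.IsAlgebraicAction G Z) :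
    Equivalence (fun z₁ z₂ : Z => AffineGIT.ClosuresMeet G z₁ z₂) ∧
    (∀ z₁ z₂ : Z, AffineGIT.ClosuresMeet G z₁ z₂ ↔
      ∀ f ∈ AffineGIT.invariantRing G Z, f z₁ = f z₂) ∧
    (∀ z : Z, ∃ C : Set Z,
      AffineGIT.IsClosedOrbitIn G z C ∧
      (∀ C' : Set Z, AffineGIT.IsClosedOrbitIn G z C' → C' = C) ∧
      (∀ w : Z, MulAction.orbit G w ⊆ AffineGIT.orbitClosure G z →
        AffineGIT.zariskiDim C ≤ AffineGIT.zariskiDim (MulAction.orbit G w))) := by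
  have hiff := AffineGIT.closuresMeet_iff hG hN hZ hact
  refine ⟨⟨fun z => (hiff z z).2 fun _ _ => rfl,
    fun {x y} h => (hiff y x).2 fun f hf => ((hiff x y).1 h f hf).symm,
    fun {x y z} h h' => (hiff x z).2 fun f hf =>
      ((hiff x y).1 h f hf).trans ((hiff y z).1 h' f hf)⟩, hiff, fun z => ?_⟩
  obtain ⟨C, hC⟩ := hact.exists_isClosedOrbitIn hG.isAffineVariety z
  refine ⟨C, hC, fun C' hC' => hC.eq hG hN hZ hact hC', fun w hw => ?_⟩
  obtain ⟨C', hC'⟩ := hact.exists_isClosedOrbitIn hG.isAffineVariety w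
  have hwz : w ∈ AffineGIT.orbitClosure G z := hw (MulAction.mem_orbit_self w)
  -- The closed orbit found in `Δ(w)` also lies in `Δ(z)`, so uniqueness identifies it with `C`.
  obtain rfl : C' = C := hC.eq hG hN hZ hact
    ⟨hC'.1, hC'.2.1, hC'.2.2.trans (hact.orbitClosure_subset hwz)⟩
  exact hact.zariskiDim_le_zariskiDim_orbit hG.isAffineVariety hC'.2.2
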